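/- Let $V$ be a finite set of random variables, each taking values in a finite set, with joint distribution $P$, let $C\in V$ be the class attribute and $F=V\setminus\{C\}$ the set of features. Let $G$ be a directed acyclic graph with node set $V$ such that $\langle V,G,P\rangle$ is a Bayesian network, i.e. the Markov condition holds: every node is independent of any subset of its non-descendants conditioned on its parents. Suppose that $P$ is faithful to $G$: whenever two distinct variables are conditionally independent in $P$ given a set $S$ of other variables, this independence is entailed by $G$ and the Markov condition, i.e. it holds in every distribution of finite-valued variables indexed by $V$ (with arbitrary finite ranges) that satisfies the Markov condition for $G$. Let $MB(C)$ be the set consisting of the parents, the children, and the spouses (other parents of the children) of $C$ in $G$. The algorithm IAMB, run with reliable tests (i.e. with the true conditional mutual informations $I(C;X\mid S)$ under $P$), starts with $S=\emptyset$. Forward phase: at each iteration a feature $X\in F\setminus S$ that maximizes $I(C;X\mid S)$ over $F\setminus S$ and satisfies $I(C;X\mid S)>0$ is added to $S$ (ties being broken arbitrarily), until $I(C;X\mid S)=0$ for all $X\in F\setminus S$. Backward phase: sequentially, some $Y\in S$ with $I(C;Y\mid S\setminus\{Y\})=0$ is removed from $S$, until $I(C;Y\mid S\setminus\{Y\})>0$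 for all $Y\in S$. Then, however the choices are made, both phases terminate, and: 1. the set $S$ obtained at the end of the forward phase contains $MB(C)$; 2. the backward phase removes from it exactly the false positives, i.e. the features not in $MB(C)$, so that the output of IAMB is exactly $MB(C)$; 3. the output is the optimal set $S^*=\arg\max_{S\subseteq F} I(C;S)$, in the sense that it maximizes $I(C;S)$ over all $S\subseteq F$ and is contained in every other maximizer. -/

import Mathlib

noncomputable section

/-! ### Finite probability: events, conditional independence, mutual information -/

section Probability

variable {V : Type*} [Fintype V] [DecidableEq V] {Ω : V → Type*} [∀ v, Fintype (Ω v)]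

/-- The probability of an event `E` under a joint distribution `P` of the variables in `V`,
the variable `v` taking values in the finite set `Ω v`. -/
def pr (P : PMF (∀ v, Ω v)) (E : Set (∀ v, Ω v)) : ℝ :=
  ∑ ω, E.indicator (fun ω => (P ω).toReal) ω

/-- The conditional probability `P(E | D)`. -/
def condPr (P : PMF (∀ v, Ω v)) (E D : Set (∀ v, Ω v)) : ℝ :=
  pr P (E ∩ D) / pr P D

/-- An assignment of values to the variables in `S`. -/
abbrev Assignment (Ω : V → Type*) (S : Finset V) : Type _ :=
  ∀ v : {v // v ∈ S}, Ω v.1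

/-- The event that every variable of `S` takes the value prescribed by `s`. -/
def event {S : Finset V} (s : Assignment Ω S) : Set (∀ v, Ω v) :=
  {ω | ∀ v : {v // v ∈ S}, ω v.1 = s v}

/-- Conditional independence of the sets of variables `A` and `B` given the set `S`:
`P(A, B | S) = P(A | S) P(B | S)`, at every value of `S` of positive probability. -/
def CondIndep (P : PMF (∀ v, Ω v)) (A B S : Finset V) : Prop :=
  ∀ (a : Assignment Ω A) (b : Assignment Ω B) (s : Assignment Ω S), 0 < pr P (event s) →
    condPr P (event a ∩ event b) (event s) =
      condPr P (event a) (event s) * condPr P (event b) (event s)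

/-- The mutual information `I(A; B) = ∑ P(a, b) log (P(a, b) / (P(a) P(b)))`
(with `0 log 0 = 0`). -/
def mutualInfo (P : PMF (∀ v, Ω v)) (A B : Finset V) : ℝ :=
  ∑ a : Assignment Ω A, ∑ b : Assignment Ω B,
    pr P (event a ∩ event b) *
      Real.log (pr P (event a ∩ event b) / (pr P (event a) * pr P (event b)))

/-- The conditional mutual information
`I(A; B | S) = ∑ P(s) ∑ P(a, b | s) log (P(a, b | s) / (P(a | s) P(b | s)))`. -/
def condMutualInfo (P : PMF (∀ v, Ω v)) (A B S : Finset V) : ℝ :=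
  ∑ s : Assignment Ω S, pr P (event s) *
    ∑ a : Assignment Ω A, ∑ b : Assignment Ω B,
      condPr P (event a ∩ event b) (event s) *
        Real.log (condPr P (event a ∩ event b) (event s) /
          (condPr P (event a) (event s) * condPr P (event b) (event s)))

end Probability

/-! ### Bayesian networks, faithfulness, Markov blankets -/

section Network

variable {V : Type*} [Fintype V]

open Classical in
/-- The parents of `v`. -/
def parents (G : Digraph V) (v : V) : Finset V :=
  Finset.univ.filter fun w => G.Adj w v

open Classical in
/-- The children of `v`. -/
def children (G : Digraph V) (v : V) : Finset V :=
  Finset.univ.filter fun w => G.Adj v w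

open Classical in
/-- The spouses of `v`: the other parents of the children of `v`. -/
def spouses (G : Digraph V) (v : V) : Finset V :=
  Finset.univ.filter fun w => w ≠ v ∧ ∃ u, G.Adj v u ∧ G.Adj w u

open Classical in
/-- The non-descendants of `v`: the nodes other than `v` that no directed path from `v` reaches. -/
def nonDescendants (G : Digraph V) (v : V) : Finset V :=
  Finset.univ.filter fun w => w ≠ v ∧ ¬ Relation.TransGen G.Adj v w

/-- `G` is a DAG: it has no directed cycle. -/
def IsDAG (G : Digraph V) : Prop :=
  ∀ v, ¬ Relation.TransGen G.Adj v v

variable [DecidableEq V]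

/-- The Markov blanket of `v`: its parents, children and spouses. -/
def markovBlanket (G : Digraph V) (v : V) : Finset V :=
  parents G v ∪ children G v ∪ spouses G v

/-- The Markov condition: every node is independent of any subset of its non-descendants
conditioned on its parents. -/
def MarkovCondition {Ω : V → Type*} [∀ v, Fintype (Ω v)]
    (G : Digraph V) (P : PMF (∀ v, Ω v)) : Prop :=
  ∀ (v : V) (T : Finset V), T ⊆ nonDescendants G v → CondIndep P {v} T (parents G v)

/-- `⟨V, G, P⟩` is a Bayesian network. -/
def IsBayesianNetwork {Ω : V → Type*} [∀ v, Fintype (Ω v)]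
    (G : Digraph V) (P : PMF (∀ v, Ω v)) : Prop :=
  IsDAG G ∧ MarkovCondition G P

/-- The independence of `i` and `j` given `S` is entailed by `G` and the Markov condition: it
holds in every distribution of `V`-indexed finite-valued variables, whatever their ranges, that
satisfies the Markov condition for `G`. -/
def Entails (G : Digraph V) (i j : V) (S : Finset V) : Prop :=
  ∀ (Ω' : V → Type) [∀ v, Fintype (Ω' v)] (Q : PMF (∀ v, Ω' v)),
    MarkovCondition G Q → CondIndep Q {i} {j} S

/-- Faithfulness: every conditional independence (between two distinct variables, given a set of
other variables) present in `P` is entailed by `G` and the Markov condition. -/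
def Faithful {Ω : V → Type*} [∀ v, Fintype (Ω v)]
    (G : Digraph V) (P : PMF (∀ v, Ω v)) : Prop :=
  ∀ (i j : V) (S : Finset V), i ≠ j → i ∉ S → j ∉ S →
    CondIndep P {i} {j} S → Entails G i j S

end Network

/-! ### The objective and the IAMB algorithm -/

section IAMB

variable {V : Type*} [Fintype V] [DecidableEq V] {Ω : V → Type*} [∀ v, Fintype (Ω v)]

/-- The features: all variables other than the class attribute `C`. -/
def features (C : V) : Finset V := Finset.univ.erase C

/-- `S` belongs to `argmax_{S ⊆ F} I(C; S)`. -/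
def IsOptimal (P : PMF (∀ v, Ω v)) (C : V) (S : Finset V) : Prop :=
  S ⊆ features C ∧ ∀ T ⊆ features C, mutualInfo P {C} T ≤ mutualInfo P {C} S

/-- One iteration of the forward phase: a feature `X` outside `S` that attains the maximum of
`I(C; X | S)`, with `I(C; X | S) > 0`, is added to `S`. Ties are broken arbitrarily. -/
def ForwardStep (P : PMF (∀ v, Ω v)) (C : V) (S S' : Finset V) : Prop :=
  ∃ X ∈ features C \ S,
    (∀ Z ∈ features C \ S, condMutualInfo P {C} {Z} S ≤ condMutualInfo P {C} {X} S) ∧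
    0 < condMutualInfo P {C} {X} S ∧ S' = insert X S

/-- The stopping criterion of the forward phase. -/
def ForwardStop (P : PMF (∀ v, Ω v)) (C : V) (S : Finset V) : Prop :=
  ∀ X ∈ features C \ S, condMutualInfo P {C} {X} S = 0

/-- One iteration of the backward phase: some `Y ∈ S` with `I(C; Y | S \ Y) = 0` is removed. -/
def BackwardStep (P : PMF (∀ v, Ω v)) (C : V) (S S' : Finset V) : Prop :=
  ∃ Y ∈ S, condMutualInfo P {C} {Y} (S.erase Y) = 0 ∧ S' = S.erase Y

/-- The stopping criterion of the backward phase. -/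
def BackwardStop (P : PMF (∀ v, Ω v)) (C : V) (S : Finset V) : Prop :=
  ∀ Y ∈ S, 0 < condMutualInfo P {C} {Y} (S.erase Y)

/-- Every execution of the loop with body `step` and exit condition `halt` that starts in state
`s` reaches the exit: it cannot go on forever and it cannot get stuck. -/
def LoopTerminates {σ : Type*} (step : σ → σ → Prop) (halt : σ → Prop) (s : σ) : Prop :=
  (¬ ∃ r : ℕ → σ, r 0 = s ∧ ∀ n, step (r n) (r (n + 1))) ∧
    ∀ t, Relation.ReflTransGen step s t → halt t ∨ ∃ t', step t t'

/-- `t` is a possible result of the loop with body `step` and exit condition `halt`, started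
in state `s`. -/
def LoopResult {σ : Type*} (step : σ → σ → Prop) (halt : σ → Prop) (s t : σ) : Prop :=
  Relation.ReflTransGen step s t ∧ halt t

/-- `S` is a possible result of the forward phase, which starts from the empty set. -/
def IsForwardResult (P : PMF (∀ v, Ω v)) (C : V) (S : Finset V) : Prop :=
  LoopResult (ForwardStep P C) (ForwardStop P C) ∅ S

/-- `T` is a possible result of the backward phase started from `S`. -/
def IsBackwardResult (P : PMF (∀ v, Ω v)) (C : V) (S T : Finset V) : Prop :=
  LoopResult (BackwardStep P C) (BackwardStop P C) S T

/-- `T` is a possible output of IAMB, the conditional mutual informations being the true ones. -/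
def IsIAMBOutput (P : PMF (∀ v, Ω v)) (C : V) (T : Finset V) : Prop :=
  ∃ S, IsForwardResult P C S ∧ IsBackwardResult P C S T

end IAMB

end

/-!
IAMB is correct because of three facts about the Markov blanket `M` of `C`.

*Information.* Conditional mutual information is a signed sum of entropies, so it satisfies the
chain rule `I(C; B ∪ S) = I(C; S) + I(C; B | S)` (`mutualInfo_union`). By Gibbs' inequality it is
nonnegative, and it vanishes exactly at conditional independence
(`condMutualInfo_eq_zero_iff`). Hence `I(C; ·)` is monotone.

*Sufficiency of `M`.* On a DAG the Markov condition makes the joint distribution the product of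
the local factors `P(v | parents of v)` (`marg_eq_prod`). Only the factors of `C` and of its
children involve `C`, and they involve nothing outside `M ∪ {C}`; so `I(C; F | M) = 0` for the set
`F` of features (`condMutualInfo_markovBlanket`). By monotonicity, every set of features containing
`M` carries the maximal information `I(C; F)`, and nothing outside it adds any.

*Necessity of `M`.* By faithfulness, a dependence follows as soon as one Markov model of `G`
exhibits it, and two Boolean models are enough; d-separation is not needed. If `i → j` is an edge,
let `j` copy a fair coin tossed at `i` (`not_entails_of_adj`); so parents and children of `C` are
dependent on `C` given any set. If `i → k ← j`, let `k` be the exclusive or of two independent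
coins `i` and `j` (`not_entails_of_collider`); so a spouse is dependent on `C` given any set that
contains the common child. Therefore a set given which no other feature depends on `C` contains
the children, hence also the spouses
(`Faithful.markovBlanket_subset_of_condIndep`). This applies to every result of the forward phase
and to every maximizer of `I(C; ·)`. The same models show that the backward phase never removes an
element of `M`, while sufficiency shows that it cannot stop before all the others are gone.
-/

noncomputable section

/-! ### Cylinders, marginals and entropy -/

section Cylinders

variable {V : Type*} {Ω : V → Type*}

/-- The values that the outcome `ω` gives to the variables in `A`. -/
def restr (A : Finset V) (ω : ∀ v, Ω v) : Assignment Ω A := fun v => ω v.1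

lemma mem_event_iff {A : Finset V} (a : Assignment Ω A) (ω : ∀ v, Ω v) :
    ω ∈ event a ↔ a = restr A ω := by
  simp only [event, Set.mem_ofPred_eq, restr, funext_iff]
  exact forall_congr' fun v => eq_comm

/-- The cylinder of the outcomes that agree with `ω` on the variables in `A`. -/
def cyl (A : Finset V) (ω : ∀ v, Ω v) : Set (∀ v, Ω v) := {ω' | ∀ v ∈ A, ω' v = ω v}

lemma event_restr (A : Finset V) (ω : ∀ v, Ω v) : event (restr A ω) = cyl A ω := by
  ext ω'
  simp [event, cyl, restr]

lemma cyl_inter_cyl [DecidableEq V] (A B : Finset V) (ω : ∀ v, Ω v) :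
    cyl A ω ∩ cyl B ω = cyl (A ∪ B) ω := by
  ext ω'
  simp only [cyl, Set.mem_inter_iff, Set.mem_ofPred_eq, Finset.mem_union]
  grind

lemma cyl_congr {A : Finset V} {ω ω' : ∀ v, Ω v} (h : ∀ v ∈ A, ω v = ω' v) :
    cyl A ω = cyl A ω' := by
  ext η
  simp only [cyl, Set.mem_ofPred_eq]
  grind

end Cylinders

section Entropy

variable {V : Type*} [Fintype V] [DecidableEq V] {Ω : V → Type*} [∀ v, Fintype (Ω v)]

lemma pr_nonneg (P : PMF (∀ v, Ω v)) (E : Set (∀ v, Ω v)) : 0 ≤ pr P E :=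
  Finset.sum_nonneg fun _ _ => Set.indicator_nonneg (fun _ _ => ENNReal.toReal_nonneg) _

lemma pr_mono (P : PMF (∀ v, Ω v)) {D E : Set (∀ v, Ω v)} (h : D ⊆ E) : pr P D ≤ pr P E :=
  Finset.sum_le_sum fun _ _ =>
    Set.indicator_le_indicator_of_subset h (fun _ => ENNReal.toReal_nonneg) _

lemma pr_univ (P : PMF (∀ v, Ω v)) : pr P Set.univ = 1 := by
  have h := P.tsum_coe
  rw [tsum_fintype] at h
  simp only [pr, Set.indicator_univ]
  rw [← ENNReal.toReal_sum fun ω _ => P.apply_ne_top ω, h, ENNReal.toReal_one]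

/-- Multiplying back by the probability of the conditioning event is harmless even when that
probability vanishes, because the joint probability then vanishes too. -/
lemma pr_mul_condPr (P : PMF (∀ v, Ω v)) (E D : Set (∀ v, Ω v)) :
    pr P D * condPr P E D = pr P (E ∩ D) := by
  unfold condPr
  by_cases h : pr P D = 0
  · have := pr_mono P (Set.inter_subset_right : E ∩ D ⊆ D)
    have := pr_nonneg P (E ∩ D)
    rw [h]; linarith
  · field_simp

lemma condPr_nonneg (P : PMF (∀ v, Ω v)) (E D : Set (∀ v, Ω v)) : 0 ≤ condPr P E D :=
  div_nonneg (pr_nonneg _ _) (pr_nonneg _ _)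

/-- The marginal probability of the values that `ω` gives to the variables in `A`. -/
def marg (P : PMF (∀ v, Ω v)) (A : Finset V) (ω : ∀ v, Ω v) : ℝ := pr P (cyl A ω)

lemma marg_univ (P : PMF (∀ v, Ω v)) (ω : ∀ v, Ω v) :
    marg P Finset.univ ω = (P ω).toReal := by
  classical
  have : cyl Finset.univ ω = {ω} := by
    ext ω'
    simp [cyl, funext_iff]
  simp [marg, pr, this, Set.indicator_apply]

lemma marg_pos (P : PMF (∀ v, Ω v)) (A : Finset V) {ω : ∀ v, Ω v} (h : (P ω).toReal ≠ 0) :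
    0 < marg P A ω := by
  have h1 : marg P Finset.univ ω ≤ marg P A ω :=
    pr_mono P fun ω' h v _ => h v (Finset.mem_univ v)
  rw [marg_univ] at h1
  exact lt_of_lt_of_le (lt_of_le_of_ne ENNReal.toReal_nonneg h.symm) h1

/-- The Shannon entropy of the variables in `A`, written as an expectation over outcomes. -/
def entropy (P : PMF (∀ v, Ω v)) (A : Finset V) : ℝ :=
  -∑ ω, (P ω).toReal * Real.log (marg P A ω)

/-- Summing over the values of `S`, `A`, `B` against their joint distribution is taking an
expectation over outcomes. -/
lemma sum_pr_event_mul (P : PMF (∀ v, Ω v)) (A B S : Finset V)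
    (g : Assignment Ω A → Assignment Ω B → Assignment Ω S → ℝ) :
    ∑ s, ∑ a, ∑ b, pr P (event a ∩ event b ∩ event s) * g a b s =
      ∑ ω, (P ω).toReal * g (restr A ω) (restr B ω) (restr S ω) := by
  classical
  simp only [pr, Finset.sum_mul]
  have h : ∀ (s : Assignment Ω S) (a : Assignment Ω A),
      ∑ b : Assignment Ω B, ∑ ω, (event a ∩ event b ∩ event s).indicator
        (fun ω => (P ω).toReal) ω * g a b s =
      ∑ ω, ∑ b : Assignment Ω B, (event a ∩ event b ∩ event s).indicator
        (fun ω => (P ω).toReal) ω * g a b s := fun s a => Finset.sum_comm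
  simp only [h]
  have h' : ∀ (s : Assignment Ω S),
      ∑ a : Assignment Ω A, ∑ ω, ∑ b : Assignment Ω B, (event a ∩ event b ∩ event s).indicator
        (fun ω => (P ω).toReal) ω * g a b s =
      ∑ ω, ∑ a : Assignment Ω A, ∑ b : Assignment Ω B, (event a ∩ event b ∩ event s).indicator
        (fun ω => (P ω).toReal) ω * g a b s := fun s => Finset.sum_comm
  simp only [h']
  rw [Finset.sum_comm]
  refine Finset.sum_congr rfl fun ω _ => ?_
  rw [Fintype.sum_eq_single (restr S ω), Fintype.sum_eq_single (restr A ω),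
    Fintype.sum_eq_single (restr B ω)]
  · rw [Set.indicator_of_mem]
    simp [mem_event_iff]
  · intro b hb
    rw [Set.indicator_of_notMem, zero_mul]
    simp [mem_event_iff, hb]
  · intro a ha
    refine Finset.sum_eq_zero fun b _ => ?_
    rw [Set.indicator_of_notMem, zero_mul]
    simp [mem_event_iff, ha]
  · intro s hs
    refine Finset.sum_eq_zero fun a _ => Finset.sum_eq_zero fun b _ => ?_
    rw [Set.indicator_of_notMem, zero_mul]
    simp [mem_event_iff, hs]

lemma condMutualInfo_eq_entropy (P : PMF (∀ v, Ω v)) (A B S : Finset V) :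
    condMutualInfo P A B S =
      entropy P (A ∪ S) + entropy P (B ∪ S) - entropy P (A ∪ B ∪ S) - entropy P S := by
  have h : condMutualInfo P A B S =
      ∑ s : Assignment Ω S, ∑ a : Assignment Ω A, ∑ b : Assignment Ω B,
        pr P (event a ∩ event b ∩ event s) *
        Real.log (condPr P (event a ∩ event b) (event s) /
          (condPr P (event a) (event s) * condPr P (event b) (event s))) := by
    simp only [condMutualInfo, Finset.mul_sum, ← mul_assoc, pr_mul_condPr]
  rw [h, sum_pr_event_mul P A B S fun a b s =>
    Real.log (condPr P (event a ∩ event b) (event s) /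
      (condPr P (event a) (event s) * condPr P (event b) (event s)))]
  trans ∑ ω, (P ω).toReal * (Real.log (marg P (A ∪ B ∪ S) ω) + Real.log (marg P S ω) -
    Real.log (marg P (A ∪ S) ω) - Real.log (marg P (B ∪ S) ω))
  swap
  · simp only [entropy, mul_add, mul_sub, Finset.sum_add_distrib, Finset.sum_sub_distrib]
    ring
  refine Finset.sum_congr rfl fun ω _ => ?_
  by_cases h0 : (P ω).toReal = 0
  · simp [h0]
  · simp only [condPr, event_restr, cyl_inter_cyl]
    have h1 := marg_pos P (A ∪ S) h0
    have h2 := marg_pos P (B ∪ S) h0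
    have h3 := marg_pos P (A ∪ B ∪ S) h0
    have h4 := marg_pos P S h0
    simp only [marg] at *
    have : ∀ x y z w : ℝ, 0 < x → 0 < y → 0 < z → 0 < w →
        Real.log (x / w / (y / w * (z / w))) =
          Real.log x + Real.log w - Real.log y - Real.log z := by
      intro x y z w hx hy hz hw
      rw [Real.log_div (by positivity) (by positivity), Real.log_mul (by positivity)
        (by positivity), Real.log_div hx.ne' hw.ne', Real.log_div hy.ne' hw.ne',
        Real.log_div hz.ne' hw.ne']
      ring
    rw [this _ _ _ _ h3 h1 h2 h4]

lemma mutualInfo_eq_condMutualInfo_empty (P : PMF (∀ v, Ω v)) (A B : Finset V) :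
    mutualInfo P A B = condMutualInfo P A B ∅ := by
  have h : ∀ s : Assignment Ω (∅ : Finset V), event s = Set.univ := fun s => by
    ext ω; simp [event]
  have : Unique (Assignment Ω (∅ : Finset V)) :=
    { default := fun v => absurd v.2 (Finset.notMem_empty _)
      uniq := fun _ => funext fun v => absurd v.2 (Finset.notMem_empty _) }
  simp [mutualInfo, condMutualInfo, condPr, h, pr_univ]

/-- The chain rule for mutual information; `B` and `S` need not be disjoint. -/
lemma mutualInfo_union (P : PMF (∀ v, Ω v)) (A B S : Finset V) :
    mutualInfo P A (B ∪ S) = mutualInfo P A S + condMutualInfo P A B S := by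
  simp only [mutualInfo_eq_condMutualInfo_empty, condMutualInfo_eq_entropy, Finset.union_empty,
    Finset.union_assoc]
  ring

/-- The Gibbs inequality for two nonnegative functions of equal total mass, with its
equality case. -/
lemma sum_mul_log_div_nonneg {ι : Type*} [Fintype ι] {q r : ι → ℝ} (hq : ∀ i, 0 ≤ q i)
    (hr : ∀ i, 0 ≤ r i) (hqr : ∀ i, r i = 0 → q i = 0) (hsum : ∑ i, q i = ∑ i, r i) :
    0 ≤ ∑ i, q i * Real.log (q i / r i) ∧
      (∑ i, q i * Real.log (q i / r i) = 0 ↔ ∀ i, q i = r i) := by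
  have hterm : ∀ i, r i * InformationTheory.klFun (q i / r i) =
      q i * Real.log (q i / r i) + r i - q i := by
    intro i
    by_cases h : r i = 0
    · simp [h, hqr i h]
    · unfold InformationTheory.klFun
      field_simp
  have hs : ∑ i, q i * Real.log (q i / r i) =
      ∑ i, r i * InformationTheory.klFun (q i / r i) := by
    simp only [hterm, Finset.sum_sub_distrib, Finset.sum_add_distrib, hsum]
    ring
  have hnn : ∀ i, 0 ≤ r i * InformationTheory.klFun (q i / r i) := fun i =>
    mul_nonneg (hr i) (InformationTheory.klFun_nonneg (div_nonneg (hq i) (hr i)))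
  rw [hs]
  refine ⟨Finset.sum_nonneg fun i _ => hnn i, ?_⟩
  rw [Finset.sum_eq_zero_iff_of_nonneg fun i _ => hnn i]
  refine forall_congr' fun i => ?_
  simp only [Finset.mem_univ, true_imp_iff, mul_eq_zero,
    InformationTheory.klFun_eq_zero_iff (div_nonneg (hq i) (hr i))]
  by_cases h : r i = 0
  · simp [h, hqr i h]
  · simp [h, div_eq_one_iff_eq h]

lemma sum_pr_event_inter (P : PMF (∀ v, Ω v)) (A : Finset V) (E : Set (∀ v, Ω v)) :
    ∑ a : Assignment Ω A, pr P (event a ∩ E) = pr P E := by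
  classical
  simp only [pr]
  rw [Finset.sum_comm]
  refine Finset.sum_congr rfl fun ω _ => ?_
  rw [Fintype.sum_eq_single (restr A ω)]
  · simp [Set.indicator_apply, mem_event_iff]
  · intro a ha
    rw [Set.indicator_of_notMem]
    simp [mem_event_iff, ha]

/-- The inner sum of the conditional mutual information is a relative entropy, so Gibbs'
inequality applies to it. -/
lemma sum_condPr_log_nonneg (P : PMF (∀ v, Ω v)) (A B : Finset V) {D : Set (∀ v, Ω v)}
    (hD : 0 < pr P D) :
    0 ≤ ∑ a : Assignment Ω A, ∑ b : Assignment Ω B, condPr P (event a ∩ event b) D *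
        Real.log (condPr P (event a ∩ event b) D /
          (condPr P (event a) D * condPr P (event b) D)) ∧
    (∑ a : Assignment Ω A, ∑ b : Assignment Ω B, condPr P (event a ∩ event b) D *
        Real.log (condPr P (event a ∩ event b) D /
          (condPr P (event a) D * condPr P (event b) D)) = 0 ↔
      ∀ (a : Assignment Ω A) (b : Assignment Ω B), condPr P (event a ∩ event b) D =
        condPr P (event a) D * condPr P (event b) D) := by
  have hone : ∀ A : Finset V, ∑ a : Assignment Ω A, condPr P (event a) D = 1 := fun A => by
    simp only [condPr, ← Finset.sum_div, sum_pr_event_inter, div_self hD.ne']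
  have hjoint : ∀ a : Assignment Ω A,
      ∑ b : Assignment Ω B, condPr P (event a ∩ event b) D = condPr P (event a) D := fun a => by
    simp only [condPr, ← Finset.sum_div, Set.inter_comm (event a), Set.inter_assoc,
      sum_pr_event_inter]
  have hle : ∀ E E' : Set (∀ v, Ω v), E ⊆ E' → condPr P E D ≤ condPr P E' D := fun E E' h =>
    div_le_div_of_nonneg_right (pr_mono P (Set.inter_subset_inter_left _ h)) hD.le
  have key := sum_mul_log_div_nonneg (ι := Assignment Ω A × Assignment Ω B)
    (q := fun p => condPr P (event p.1 ∩ event p.2) D)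
    (r := fun p => condPr P (event p.1) D * condPr P (event p.2) D)
    (fun _ => condPr_nonneg _ _ _)
    (fun _ => mul_nonneg (condPr_nonneg _ _ _) (condPr_nonneg _ _ _))
    (by
      intro p h
      rcases mul_eq_zero.1 h with h | h
      · exact le_antisymm (h ▸ hle _ _ Set.inter_subset_left) (condPr_nonneg _ _ _)
      · exact le_antisymm (h ▸ hle _ _ Set.inter_subset_right) (condPr_nonneg _ _ _))
    (by simp only [Fintype.sum_prod_type, hjoint, ← Finset.mul_sum, hone, mul_one])
  simpa only [Fintype.sum_prod_type, Prod.forall] using key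

lemma condMutualInfo_nonneg (P : PMF (∀ v, Ω v)) (A B S : Finset V) :
    0 ≤ condMutualInfo P A B S := by
  refine Finset.sum_nonneg fun s _ => ?_
  rcases (pr_nonneg P (event s)).eq_or_lt with h | h
  · simp [← h]
  · exact mul_nonneg h.le (sum_condPr_log_nonneg P A B h).1

lemma condMutualInfo_eq_zero_iff (P : PMF (∀ v, Ω v)) (A B S : Finset V) :
    condMutualInfo P A B S = 0 ↔ CondIndep P A B S := by
  have hterm : ∀ s : Assignment Ω S, pr P (event s) * ∑ a : Assignment Ω A,
      ∑ b : Assignment Ω B, condPr P (event a ∩ event b) (event s) *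
        Real.log (condPr P (event a ∩ event b) (event s) /
          (condPr P (event a) (event s) * condPr P (event b) (event s))) = 0 ↔
      (0 < pr P (event s) → ∀ (a : Assignment Ω A) (b : Assignment Ω B),
        condPr P (event a ∩ event b) (event s) =
          condPr P (event a) (event s) * condPr P (event b) (event s)) := fun s => by
    rcases (pr_nonneg P (event s)).eq_or_lt with h | h
    · simp [← h]
    · simp only [mul_eq_zero, h.ne', false_or, h, true_imp_iff]
      exact (sum_condPr_log_nonneg P A B h).2
  unfold condMutualInfo CondIndep
  rw [Finset.sum_eq_zero_iff_of_nonneg]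
  · simp only [Finset.mem_univ, true_imp_iff, hterm]
    grind
  · intro s _
    rcases (pr_nonneg P (event s)).eq_or_lt with h | h
    · simp [← h]
    · exact mul_nonneg h.le (sum_condPr_log_nonneg P A B h).1

lemma mutualInfo_mono (P : PMF (∀ v, Ω v)) (A : Finset V) {S T : Finset V} (h : S ⊆ T) :
    mutualInfo P A S ≤ mutualInfo P A T := by
  have := mutualInfo_union P A T S
  rw [Finset.union_eq_left.2 h] at this
  have := condMutualInfo_nonneg P A T S
  linarith

end Entropy

/-! ### The recursive factorization and the Markov blanket -/

section Graph

variable {V : Type*} {G : Digraph V}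

lemma IsDAG.not_adj_self (hG : IsDAG G) (v : V) : ¬ G.Adj v v :=
  fun h => hG v (.single h)

lemma IsDAG.ne_of_adj (hG : IsDAG G) {v w : V} (h : G.Adj v w) : v ≠ w := by
  rintro rfl
  exact hG.not_adj_self v h

variable [Fintype V]

lemma mem_parents {v w : V} : w ∈ parents G v ↔ G.Adj w v := by
  simp [parents]

lemma mem_children {v w : V} : w ∈ children G v ↔ G.Adj v w := by
  simp [children]

lemma mem_spouses {v w : V} :
    w ∈ spouses G v ↔ w ≠ v ∧ ∃ u, G.Adj v u ∧ G.Adj w u := by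
  simp [spouses]

lemma mem_nonDescendants {v w : V} :
    w ∈ nonDescendants G v ↔ w ≠ v ∧ ¬ Relation.TransGen G.Adj v w := by
  simp [nonDescendants]

lemma mem_markovBlanket [DecidableEq V] {v w : V} : w ∈ markovBlanket G v ↔
    G.Adj w v ∨ G.Adj v w ∨ (w ≠ v ∧ ∃ u, G.Adj v u ∧ G.Adj w u) := by
  simp [markovBlanket, mem_parents, mem_children, mem_spouses]

lemma IsDAG.notMem_markovBlanket [DecidableEq V] (hG : IsDAG G) (v : V) :
    v ∉ markovBlanket G v := by
  simp [mem_markovBlanket, hG.not_adj_self]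

lemma IsDAG.parents_subset_nonDescendants (hG : IsDAG G) (v : V) :
    parents G v ⊆ nonDescendants G v := fun w hw => by
  rw [mem_parents] at hw
  exact mem_nonDescendants.2 ⟨hG.ne_of_adj hw, fun h => hG v (h.tail hw)⟩

/-- A nonempty set of nodes of a DAG has a node without descendants in the set. -/
lemma IsDAG.exists_sink (hG : IsDAG G) {A : Finset V} (hA : A.Nonempty) :
    ∃ v ∈ A, ∀ w ∈ A, ¬ Relation.TransGen G.Adj v w := by
  let r : V → V → Prop := fun w v => Relation.TransGen G.Adj v w
  have : IsTrans V r := ⟨fun _ _ _ h h' => Relation.TransGen.trans h' h⟩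
  have : Std.Irrefl r := ⟨hG⟩
  obtain ⟨v, hv, h⟩ := (Finite.wellFounded_of_trans_of_irrefl r).has_min (A : Set V) hA
  exact ⟨v, hv, h⟩

end Graph

section Factorization

variable {V : Type*} [Fintype V] [DecidableEq V] {Ω : V → Type*} [∀ v, Fintype (Ω v)]

/-- The probability of the value of `v` given the values of its parents. -/
def localFactor (G : Digraph V) (P : PMF (∀ v, Ω v)) (v : V) (ω : ∀ v, Ω v) : ℝ :=
  condPr P (cyl {v} ω) (cyl (parents G v) ω)

lemma localFactor_nonneg (G : Digraph V) (P : PMF (∀ v, Ω v)) (v : V) (ω : ∀ v, Ω v) :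
    0 ≤ localFactor G P v ω :=
  condPr_nonneg _ _ _

lemma localFactor_congr {G : Digraph V} (P : PMF (∀ v, Ω v)) {v : V} {ω ω' : ∀ v, Ω v}
    (hv : ω v = ω' v) (h : ∀ w, G.Adj w v → ω w = ω' w) :
    localFactor G P v ω = localFactor G P v ω' := by
  unfold localFactor
  rw [cyl_congr (A := {v}) (ω' := ω') (by simpa using hv),
    cyl_congr (A := parents G v) fun w hw => h w (mem_parents.1 hw)]

/-- The marginal of a set of nodes closed under parents is the product of the local factors. -/
lemma marg_eq_prod {G : Digraph V} {P : PMF (∀ v, Ω v)} (h : IsBayesianNetwork G P)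
    (ω : ∀ v, Ω v) (A : Finset V) (hA : ∀ v ∈ A, parents G v ⊆ A) :
    marg P A ω = ∏ v ∈ A, localFactor G P v ω := by
  induction A using Finset.strongInduction with
  | H A ih =>
    rcases A.eq_empty_or_nonempty with rfl | hne
    · rw [Finset.prod_empty, marg, ← pr_univ P]
      congr 1
      ext; simp [cyl]
    obtain ⟨v, hv, hsink⟩ := h.1.exists_sink hne
    have hpa : parents G v ⊆ A.erase v := fun w hw =>
      Finset.mem_erase.2 ⟨h.1.ne_of_adj (mem_parents.1 hw), hA v hv hw⟩
    have hnd : A.erase v ⊆ nonDescendants G v := fun w hw => by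
      rw [Finset.mem_erase] at hw
      exact mem_nonDescendants.2 ⟨hw.1, hsink w hw.2⟩
    have hanc : ∀ w ∈ A.erase v, parents G w ⊆ A.erase v := fun w hw u hu => by
      have hw' := Finset.mem_of_mem_erase hw
      refine Finset.mem_erase.2 ⟨?_, hA w hw' hu⟩
      rintro rfl
      exact hsink w hw' (.single (mem_parents.1 hu))
    rw [← Finset.mul_prod_erase A _ hv, ← ih _ (Finset.erase_ssubset hv) hanc]
    have hci := h.2 v _ hnd (restr {v} ω) (restr (A.erase v) ω) (restr (parents G v) ω)
    simp only [event_restr, cyl_inter_cyl] at hci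
    have hu : {v} ∪ A.erase v = A := by
      rw [← Finset.insert_eq, Finset.insert_erase hv]
    have h1 := pr_mul_condPr P (cyl A ω) (cyl (parents G v) ω)
    have h2 := pr_mul_condPr P (cyl (A.erase v) ω) (cyl (parents G v) ω)
    rw [cyl_inter_cyl, Finset.union_eq_left.2 hpa] at h2
    rw [cyl_inter_cyl, Finset.union_eq_left.2 (hpa.trans (Finset.erase_subset _ _))] at h1
    rw [hu] at hci
    unfold marg localFactor
    rcases (pr_nonneg P (cyl (parents G v) ω)).eq_or_lt with h0 | h0
    · rw [← h1, ← h2, ← h0]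
      ring
    · rw [← h1, ← h2, hci h0]
      ring

lemma marg_features (P : PMF (∀ v, Ω v)) (C : V) (ω : ∀ v, Ω v) :
    marg P (features C) ω = ∑ c, marg P Finset.univ (Function.update ω C c) := by
  classical
  simp only [marg_univ]
  have h : ∀ ω', (cyl (features C) ω).indicator (fun ω => (P ω).toReal) ω' =
      ∑ c, if ω' = Function.update ω C c then (P ω').toReal else 0 := fun ω' => by
    have hiff : ∀ c, ω' = Function.update ω C c ↔ ω' ∈ cyl (features C) ω ∧ ω' C = c := by
      intro c
      rw [Function.eq_update_iff]
      simp [cyl, features, and_comm]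
    simp only [hiff, Set.indicator_apply, ite_and]
    split_ifs <;> simp
  simp only [marg, pr, h]
  rw [Finset.sum_comm]
  simp

/-- If the conditional probability of `C` given all the features depends only on `C` and on the
features in `S`, then it is the conditional probability of `C` given `S`. -/
lemma marg_insert_eq_mul (P : PMF (∀ v, Ω v)) {C : V} {S : Finset V} (hC : C ∉ S)
    (r : (∀ v, Ω v) → ℝ)
    (hr : ∀ ω ω', (∀ v ∈ insert C S, ω v = ω' v) → r ω = r ω')
    (h : ∀ ω, marg P Finset.univ ω = r ω * marg P (features C) ω) (ω : ∀ v, Ω v) :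
    marg P (insert C S) ω = r ω * marg P S ω := by
  classical
  have hiff : ∀ ω' ω'', (ω' ∈ cyl (insert C S) ω ∧ ω'' ∈ cyl (features C) ω') ↔
      ω' = Function.update ω'' C (ω C) ∧ ω'' ∈ cyl S ω := by
    intro ω' ω''
    rw [Function.eq_update_iff]
    simp only [cyl, features, Set.mem_ofPred_eq, Finset.mem_insert, Finset.mem_erase,
      Finset.mem_univ, and_true]
    constructor
    · rintro ⟨h1, h2⟩
      refine ⟨⟨h1 C (.inl rfl), fun v hv => (h2 v hv).symm⟩, fun v hv => ?_⟩
      have hvC : v ≠ C := fun e => hC (e ▸ hv)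
      rw [h2 v hvC, h1 v (.inr hv)]
    · rintro ⟨⟨h1, h2⟩, h3⟩
      refine ⟨?_, fun v hv => (h2 v hv).symm⟩
      rintro v (rfl | hv)
      · exact h1
      · have hvC : v ≠ C := fun e => hC (e ▸ hv)
        rw [h2 v hvC, h3 v hv]
  calc marg P (insert C S) ω
      = ∑ ω', if ω' ∈ cyl (insert C S) ω then r ω * marg P (features C) ω' else 0 := by
        rw [marg, pr]
        refine Finset.sum_congr rfl fun ω' _ => ?_
        rw [Set.indicator_apply]
        split_ifs with hω'
        · rw [← marg_univ, h, hr ω' ω hω']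
        · rfl
    _ = ∑ ω', ∑ ω'', if ω' = Function.update ω'' C (ω C) ∧ ω'' ∈ cyl S ω then
          r ω * (P ω'').toReal else 0 := by
        refine Finset.sum_congr rfl fun ω' _ => ?_
        simp only [← hiff, ite_and, marg, pr, Finset.mul_sum, Set.indicator_apply]
        split_ifs <;> simp
    _ = r ω * marg P S ω := by
        rw [Finset.sum_comm, marg, pr, Finset.mul_sum]
        refine Finset.sum_congr rfl fun ω'' _ => ?_
        simp only [ite_and, Finset.sum_ite_eq', Finset.mem_univ, if_true, Set.indicator_apply,
          mul_ite, mul_zero]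

/-- A variable shares no information with the others once its Markov blanket is known.
In the product of the local factors the variable `C` occurs only in its own factor and in those
of its children, and these involve no variables besides `C` and its Markov blanket. -/
lemma condMutualInfo_markovBlanket {G : Digraph V} {P : PMF (∀ v, Ω v)}
    (h : IsBayesianNetwork G P) (C : V) :
    condMutualInfo P {C} (features C) (markovBlanket G C) = 0 := by
  classical
  have hC := h.1.notMem_markovBlanket C
  set K := insert C (children G C) with hK
  let f : (∀ v, Ω v) → ℝ := fun ω => ∏ v ∈ K, localFactor G P v ω
  let g : (∀ v, Ω v) → ℝ := fun ω => ∏ v ∈ Kᶜ, localFactor G P v ω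
  have hfg : ∀ ω, marg P Finset.univ ω = f ω * g ω := fun ω => by
    rw [marg_eq_prod h ω _ fun _ _ => Finset.subset_univ _, Finset.prod_mul_prod_compl]
  have hfnn : ∀ ω, 0 ≤ f ω := fun ω => Finset.prod_nonneg fun v _ => localFactor_nonneg _ _ _ _
  have hf : ∀ ω ω', (∀ v ∈ insert C (markovBlanket G C), ω v = ω' v) → f ω = f ω' := by
    intro ω ω' hω
    refine Finset.prod_congr rfl fun v hv => localFactor_congr P ?_ fun w hw => ?_
    · apply hω
      simp only [hK, Finset.mem_insert, mem_children, mem_markovBlanket] at hv ⊢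
      tauto
    · apply hω
      simp only [hK, Finset.mem_insert, mem_children, mem_markovBlanket] at hv ⊢
      rcases hv with rfl | hv
      · tauto
      · by_cases e : w = C
        · exact .inl e
        · exact .inr (.inr (.inr ⟨e, v, hv, hw⟩))
  have hg : ∀ ω c, g (Function.update ω C c) = g ω := by
    intro ω c
    refine Finset.prod_congr rfl fun v hv => ?_
    simp only [hK, Finset.mem_compl, Finset.mem_insert, mem_children, not_or] at hv
    refine localFactor_congr P (Function.update_of_ne hv.1 _ _) fun w hw => ?_
    refine Function.update_of_ne ?_ _ _
    rintro rfl
    exact hv.2 hw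
  let φ : (∀ v, Ω v) → ℝ := fun ω => ∑ c, f (Function.update ω C c)
  have hF : ∀ ω, marg P (features C) ω = φ ω * g ω := fun ω => by
    simp only [marg_features, hfg, hg, φ, Finset.sum_mul]
  have hφ : ∀ ω ω', (∀ v ∈ insert C (markovBlanket G C), ω v = ω' v) → φ ω = φ ω' := by
    intro ω ω' hω
    refine Finset.sum_congr rfl fun c _ => hf _ _ fun v hv => ?_
    by_cases e : v = C
    · subst e; simp
    · simp [Function.update_of_ne e, hω v hv]
  have hr : ∀ ω, marg P Finset.univ ω = f ω / φ ω * marg P (features C) ω := by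
    intro ω
    rw [hfg, hF]
    by_cases h0 : φ ω = 0
    · -- `f ω` is one of the nonnegative summands of `φ ω`
      have : f ω = 0 := by
        have := (Finset.sum_eq_zero_iff_of_nonneg fun c _ => hfnn _).1 h0 (ω C)
          (Finset.mem_univ _)
        rwa [Function.update_eq_self] at this
      simp [this]
    · field_simp
  have key := marg_insert_eq_mul P hC (fun ω => f ω / φ ω)
    (fun ω ω' hω => by simp only [hf ω ω' hω, hφ ω ω' hω]) hr
  have hMF : markovBlanket G C ⊆ features C := fun v hv =>
    Finset.mem_erase.2 ⟨fun e => hC (e ▸ hv), Finset.mem_univ v⟩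
  have e1 : {C} ∪ features C ∪ markovBlanket G C = Finset.univ := by
    rw [← Finset.insert_eq, features, Finset.insert_erase (Finset.mem_univ C)]
    simp
  rw [condMutualInfo_eq_entropy, e1, Finset.union_eq_left.2 hMF, ← Finset.insert_eq]
  have hsum : ∀ a b c d : (∀ v, Ω v) → ℝ, (∀ ω, d ω = a ω + b ω - c ω) →
      -∑ ω, a ω + -∑ ω, b ω - -∑ ω, c ω - -∑ ω, d ω = 0 := by
    intro a b c d hd
    simp only [hd, Finset.sum_sub_distrib, Finset.sum_add_distrib]
    ring
  apply hsum
  intro ω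
  by_cases h0 : (P ω).toReal = 0
  · simp [h0]
  · have p1 := marg_pos P (insert C (markovBlanket G C)) h0
    have p2 := marg_pos P (features C) h0
    have p3 := marg_pos P Finset.univ h0
    have p4 := marg_pos P (markovBlanket G C) h0
    have hmul : marg P (insert C (markovBlanket G C)) ω * marg P (features C) ω =
        marg P Finset.univ ω * marg P (markovBlanket G C) ω := by
      rw [key, hr ω]
      ring
    have := congrArg Real.log hmul
    rw [Real.log_mul p1.ne' p2.ne', Real.log_mul p3.ne' p4.ne'] at this
    linear_combination -(P ω).toReal * this

/-- Once a set contains the Markov blanket, it determines all that the features tell about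
`C`. -/
lemma mutualInfo_eq_of_markovBlanket_subset {G : Digraph V} {P : PMF (∀ v, Ω v)}
    (h : IsBayesianNetwork G P) {C : V} {S : Finset V} (hS : markovBlanket G C ⊆ S)
    (hSF : S ⊆ features C) : mutualInfo P {C} S = mutualInfo P {C} (features C) := by
  have h1 := mutualInfo_union P {C} (features C) (markovBlanket G C)
  rw [Finset.union_eq_left.2 (hS.trans hSF), condMutualInfo_markovBlanket h] at h1
  have h2 := mutualInfo_mono P {C} hS
  have h3 := mutualInfo_mono P {C} hSF
  linarith

end Factorization

/-! ### Boolean models that witness dependence -/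

section Models

variable {V : Type*} [Fintype V] [DecidableEq V]

/-- The joint distribution of Boolean variables `ω v = φ x v`, for `x` uniformly distributed. -/
def uniformModel {α : Type} [Fintype α] [Nonempty α] (φ : α → V → Bool) : PMF (V → Bool) :=
  (PMF.uniformOfFintype α).map φ

variable {α : Type} [Fintype α] [Nonempty α] (φ : α → V → Bool)

lemma pr_uniformModel (E : Set (V → Bool)) :
    pr (Ω := fun _ : V => Bool) (uniformModel φ) E =
      ∑ x, (Fintype.card α : ℝ)⁻¹ * E.indicator 1 (φ x) := by
  classical
  have h : ∀ ω, (uniformModel φ ω).toReal =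
      ∑ x, if ω = φ x then (Fintype.card α : ℝ)⁻¹ else 0 := fun ω => by
    rw [uniformModel, PMF.map_apply, tsum_fintype, ENNReal.toReal_sum]
    · refine Finset.sum_congr rfl fun x _ => ?_
      split_ifs <;> simp
    · intro x _
      split_ifs <;> simp
  simp only [pr, Set.indicator_apply, h]
  have : ∀ ω, (if ω ∈ E then ∑ x, if ω = φ x then (Fintype.card α : ℝ)⁻¹ else 0 else 0) =
      ∑ x, if ω = φ x then (if ω ∈ E then (Fintype.card α : ℝ)⁻¹ else 0) else 0 := fun ω => by
    split_ifs <;> simp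
  simp only [this]
  rw [Finset.sum_comm]
  simp

lemma pr_uniformModel_pos {E : Set (V → Bool)} {x : α} (h : φ x ∈ E) :
    0 < pr (Ω := fun _ : V => Bool) (uniformModel φ) E := by
  classical
  rw [pr_uniformModel]
  refine Finset.sum_pos' (fun y _ => mul_nonneg (by positivity) ?_) ⟨x, Finset.mem_univ x, ?_⟩
  · exact Set.indicator_nonneg (fun _ _ => zero_le_one) _
  · rw [Set.indicator_of_mem h, Pi.one_apply]
    positivity

lemma pr_uniformModel_eq_zero {E : Set (V → Bool)} (h : ∀ x, φ x ∉ E) :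
    pr (Ω := fun _ : V => Bool) (uniformModel φ) E = 0 := by
  simp [pr_uniformModel, h]

lemma pr_uniformModel_congr {D E : Set (V → Bool)} (h : ∀ x, φ x ∈ D ↔ φ x ∈ E) :
    pr (Ω := fun _ : V => Bool) (uniformModel φ) D =
      pr (Ω := fun _ : V => Bool) (uniformModel φ) E := by
  classical
  simp [pr_uniformModel, Set.indicator_apply, h]

lemma condIndep_of_mul {Ω : V → Type*} [∀ v, Fintype (Ω v)] {P : PMF (∀ v, Ω v)}
    {A B S : Finset V}
    (h : ∀ (a : Assignment Ω A) (b : Assignment Ω B) (s : Assignment Ω S),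
      pr P (event a ∩ event b ∩ event s) * pr P (event s) =
        pr P (event a ∩ event s) * pr P (event b ∩ event s)) : CondIndep P A B S := by
  intro a b s hs
  unfold condPr
  field_simp
  rw [← h a b s]

/-- A variable that is a function of the conditioning variables is independent of anything. -/
lemma condIndep_uniformModel_of_determined {v : V} {B S : Finset V}
    (h : ∀ x y, (∀ w ∈ S, φ x w = φ y w) → φ x v = φ y v) :
    CondIndep (Ω := fun _ : V => Bool) (uniformModel φ) {v} B S := by
  refine condIndep_of_mul fun a b s => ?_
  by_cases hx : ∃ x, φ x ∈ event a ∩ event s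
  · obtain ⟨x, hxa, hxs⟩ := hx
    have hsub : ∀ y, φ y ∈ event s → φ y ∈ event a := by
      intro y hy w
      have hw : w.1 = v := Finset.mem_singleton.1 w.2
      rw [← hxa w, hw]
      exact h y x fun u hu => (hy ⟨u, hu⟩).trans (hxs ⟨u, hu⟩).symm
    rw [pr_uniformModel_congr φ (D := event a ∩ event b ∩ event s) (E := event b ∩ event s),
      pr_uniformModel_congr φ (D := event a ∩ event s) (E := event s), mul_comm]
    · intro y
      exact ⟨fun h => h.2, fun h => ⟨hsub y h, h⟩⟩
    · intro y
      exact ⟨fun h => ⟨h.1.2, h.2⟩, fun h => ⟨⟨hsub y h.2, h.1⟩, h.2⟩⟩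
  · push Not at hx
    rw [pr_uniformModel_eq_zero φ hx, pr_uniformModel_eq_zero φ fun x h => hx x ⟨h.1.1, h.2⟩]
    ring

/-- A variable that a symmetry of the sample space flips, while it fixes the variables in `B` and
`S`, is a fair coin independent of them. -/
lemma condIndep_uniformModel_of_flip {v : V} {B S : Finset V} (τ : Equiv.Perm α)
    (hv : ∀ x, φ (τ x) v ≠ φ x v) (hBS : ∀ x, ∀ w ∈ B ∪ S, φ (τ x) w = φ x w) :
    CondIndep (Ω := fun _ : V => Bool) (uniformModel φ) {v} B S := by
  classical
  -- an event in the variables of `B ∪ S` is halved by fixing the value of `v`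
  have half : ∀ (a : Assignment (fun _ : V => Bool) {v}) (E : Set (V → Bool)),
      (∀ x, φ (τ x) ∈ E ↔ φ x ∈ E) →
      pr (Ω := fun _ : V => Bool) (uniformModel φ) E =
        2 * pr (Ω := fun _ : V => Bool) (uniformModel φ) (event a ∩ E) := by
    intro a E hE
    have hmem : ∀ x, φ x ∈ event a ↔ φ x v = a ⟨v, Finset.mem_singleton_self v⟩ := by
      intro x
      refine ⟨fun h => h ⟨v, Finset.mem_singleton_self v⟩, fun h w => ?_⟩
      obtain ⟨w, hw⟩ := w
      obtain rfl := Finset.mem_singleton.1 hw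
      exact h
    rw [two_mul]
    nth_rewrite 2 [pr_uniformModel]
    rw [← Equiv.sum_comp τ, pr_uniformModel, pr_uniformModel, ← Finset.sum_add_distrib]
    refine Finset.sum_congr rfl fun x _ => ?_
    have hflip : φ (τ x) ∈ event a ↔ φ x ∉ event a := by
      rw [hmem, hmem]
      have := hv x
      revert this
      generalize φ (τ x) v = p, φ x v = q, a ⟨v, Finset.mem_singleton_self v⟩ = t
      revert p q t
      decide
    simp only [Set.indicator_apply, Set.mem_inter_iff, hflip, hE, Pi.one_apply]
    by_cases h1 : φ x ∈ event a <;> by_cases h2 : φ x ∈ E <;> simp [h1, h2]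
  refine condIndep_of_mul fun a b s => ?_
  have hs : ∀ x, φ (τ x) ∈ event s ↔ φ x ∈ event s := fun x =>
    forall_congr' fun w => by rw [hBS x w.1 (Finset.mem_union_right _ w.2)]
  have hb : ∀ x, φ (τ x) ∈ event b ↔ φ x ∈ event b := fun x =>
    forall_congr' fun w => by rw [hBS x w.1 (Finset.mem_union_left _ w.2)]
  rw [half a (event s) hs, half a (event b ∩ event s) fun x => and_congr (hb x) (hs x),
    Set.inter_assoc]
  ring

/-- A sufficient criterion for the Markov condition: every node is either a function of its
parents or a fair coin flipped by a symmetry that does not affect its non-descendants. -/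
lemma markovCondition_uniformModel {G : Digraph V} (hG : IsDAG G)
    (h : ∀ v, (∀ x y, (∀ w ∈ parents G v, φ x w = φ y w) → φ x v = φ y v) ∨
      ∃ τ : Equiv.Perm α, (∀ x, φ (τ x) v ≠ φ x v) ∧
        ∀ x, ∀ w ∈ nonDescendants G v, φ (τ x) w = φ x w) :
    MarkovCondition (Ω := fun _ : V => Bool) G (uniformModel φ) := by
  intro v T hT
  rcases h v with h | ⟨τ, hv, hτ⟩
  · exact condIndep_uniformModel_of_determined φ h
  · exact condIndep_uniformModel_of_flip φ τ hv fun x w hw =>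
      hτ x w (Finset.union_subset hT (hG.parents_subset_nonDescendants v) hw)

/-- Two values that are possible given the same values of `S`, but not jointly, witness
dependence. -/
lemma not_condIndep_uniformModel {i j : V} {S : Finset V} (x y : α)
    (hxy : ∀ w ∈ S, φ y w = φ x w)
    (hz : ∀ z, (∀ w ∈ S, φ z w = φ x w) → φ z i = φ x i → φ z j ≠ φ y j) :
    ¬ CondIndep (Ω := fun _ : V => Bool) (uniformModel φ) {i} {j} S := by
  intro h
  have key := h (restr (Ω := fun _ : V => Bool) {i} (φ x))
    (restr (Ω := fun _ : V => Bool) {j} (φ y)) (restr (Ω := fun _ : V => Bool) S (φ x))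
  simp only [event_restr] at key
  have hx : φ x ∈ cyl (Ω := fun _ : V => Bool) S (φ x) := fun _ _ => rfl
  have hy : φ y ∈ cyl (Ω := fun _ : V => Bool) S (φ x) := hxy
  have h0 := pr_uniformModel_pos φ hx
  have h1 := pr_uniformModel_pos φ (x := x)
    (E := cyl (Ω := fun _ : V => Bool) {i} (φ x) ∩ cyl S (φ x)) ⟨fun _ _ => rfl, hx⟩
  have h2 := pr_uniformModel_pos φ (x := y)
    (E := cyl (Ω := fun _ : V => Bool) {j} (φ y) ∩ cyl S (φ x)) ⟨fun _ _ => rfl, hy⟩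
  have h3 := pr_uniformModel_eq_zero φ (E := cyl (Ω := fun _ : V => Bool) {i} (φ x) ∩
      cyl {j} (φ y) ∩ cyl S (φ x)) fun z hzE =>
    hz z hzE.2 (hzE.1.1 i (Finset.mem_singleton_self i))
      (hzE.1.2 j (Finset.mem_singleton_self j))
  have := key h0
  simp only [condPr, h3, zero_div] at this
  exact (mul_pos (div_pos h1 h0) (div_pos h2 h0)).ne this

/-- The independence of adjacent nodes is not entailed: the child may copy a coin tossed by the
parent, all the other variables being constant. -/
lemma not_entails_of_adj {G : Digraph V} (hG : IsDAG G) {i j : V} (hij : G.Adj i j)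
    {S : Finset V} (hi : i ∉ S) (hj : j ∉ S) : ¬ Entails G i j S ∧ ¬ Entails G j i S := by
  let φ : Bool → V → Bool := fun x v => if v = i ∨ v = j then x else false
  have hM : MarkovCondition (Ω := fun _ : V => Bool) G (uniformModel φ) := by
    refine markovCondition_uniformModel φ hG fun v => ?_
    by_cases hvi : v = i
    · subst hvi
      refine .inr ⟨Equiv.boolNot, fun x => by simp [φ], fun x w hw => ?_⟩
      rw [mem_nonDescendants] at hw
      have hwj : w ≠ j := by
        rintro rfl
        exact hw.2 (.single hij)
      simp [φ, hw.1, hwj]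
    · refine .inl fun x y hxy => ?_
      by_cases hvj : v = j
      · subst hvj
        simpa [φ] using hxy i (mem_parents.2 hij)
      · simp [φ, hvi, hvj]
  have hS : ∀ x y, ∀ w ∈ S, φ x w = φ y w := by
    intro x y w hw
    have h1 : w ≠ i := fun e => hi (e ▸ hw)
    have h2 : w ≠ j := fun e => hj (e ▸ hw)
    simp [φ, h1, h2]
  exact ⟨fun h => not_condIndep_uniformModel φ true false (hS _ _) (fun z _ => by simp [φ])
      (h (fun _ => Bool) _ hM),
    fun h => not_condIndep_uniformModel φ true false (hS _ _) (fun z _ => by simp [φ])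
      (h (fun _ => Bool) _ hM)⟩

/-- The independence of two parents of a common child is not entailed given that child: the
parents may be independent coins and the child their exclusive or. -/
lemma not_entails_of_collider {G : Digraph V} (hG : IsDAG G) {i j k : V} (hik : G.Adj i k)
    (hjk : G.Adj j k) (hij : i ≠ j) {S : Finset V} (hi : i ∉ S) (hj : j ∉ S) (hk : k ∈ S) :
    ¬ Entails G i j S := by
  have hki := (hG.ne_of_adj hik).symm
  have hkj := (hG.ne_of_adj hjk).symm
  let φ : Bool × Bool → V → Bool := fun x v =>
    if v = i then x.1 else if v = j then x.2 else if v = k then xor x.1 x.2 else false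
  have φi : ∀ x, φ x i = x.1 := fun x => by simp [φ]
  have φj : ∀ x, φ x j = x.2 := fun x => by simp [φ, hij.symm]
  have φk : ∀ x, φ x k = xor x.1 x.2 := fun x => by simp [φ, hki, hkj]
  have φo : ∀ x v, v ≠ i → v ≠ j → v ≠ k → φ x v = false := fun x v h1 h2 h3 => by
    simp [φ, h1, h2, h3]
  have hM : MarkovCondition (Ω := fun _ : V => Bool) G (uniformModel φ) := by
    refine markovCondition_uniformModel φ hG fun v => ?_
    by_cases hvi : v = i
    · subst hvi
      refine .inr ⟨Equiv.boolNot.prodCongr (Equiv.refl _), fun x => by simp [φi],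
        fun x w hw => ?_⟩
      rw [mem_nonDescendants] at hw
      have hwk : w ≠ k := by
        rintro rfl
        exact hw.2 (.single hik)
      by_cases hwj : w = j
      · subst hwj; simp [φj]
      · rw [φo _ w hw.1 hwj hwk, φo _ w hw.1 hwj hwk]
    by_cases hvj : v = j
    · subst hvj
      refine .inr ⟨(Equiv.refl _).prodCongr Equiv.boolNot, fun x => by simp [φj],
        fun x w hw => ?_⟩
      rw [mem_nonDescendants] at hw
      have hwk : w ≠ k := by
        rintro rfl
        exact hw.2 (.single hjk)
      by_cases hwi : w = i
      · subst hwi; simp [φi]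
      · rw [φo _ w hwi hw.1 hwk, φo _ w hwi hw.1 hwk]
    refine .inl fun x y hxy => ?_
    by_cases hvk : v = k
    · subst hvk
      have h1 := hxy i (mem_parents.2 hik)
      have h2 := hxy j (mem_parents.2 hjk)
      rw [φi, φi] at h1
      rw [φj, φj] at h2
      rw [φk, φk, h1, h2]
    · rw [φo _ v hvi hvj hvk, φo _ v hvi hvj hvk]
  intro h
  refine not_condIndep_uniformModel φ (false, false) (true, true) ?_ ?_
    (h (fun _ => Bool) _ hM)
  · intro w hw
    have h1 : w ≠ i := fun e => hi (e ▸ hw)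
    have h2 : w ≠ j := fun e => hj (e ▸ hw)
    by_cases h3 : w = k
    · subst h3; simp [φk]
    · rw [φo _ w h1 h2 h3, φo _ w h1 h2 h3]
  · intro z hz h1 h2
    have h3 := hz k hk
    rw [φk, φk] at h3
    rw [φi, φi] at h1
    rw [φj, φj] at h2
    simp [h1, h2] at h3

end Models

/-! ### Correctness of IAMB -/

section Correctness

variable {V : Type*} [Fintype V] [DecidableEq V] {Ω : V → Type*} [∀ v, Fintype (Ω v)]
  {G : Digraph V} {P : PMF (∀ v, Ω v)}

lemma mem_features {C v : V} : v ∈ features C ↔ v ≠ C := by simp [features]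

/-- Under faithfulness, an element of the Markov blanket is dependent on `C` given any set that
contains the children of `C`, with the possible exception of that element. -/
lemma Faithful.not_condIndep (hF : Faithful G P) (hG : IsDAG G) {C X : V} {S : Finset V}
    (hC : C ∉ S) (hX : X ∉ S) (hXM : X ∈ markovBlanket G C)
    (hch : ∀ Y, G.Adj C Y → Y ≠ X → Y ∈ S) : ¬ CondIndep P {C} {X} S := by
  intro h
  have hCX : C ≠ X := fun e => hG.notMem_markovBlanket C (e ▸ hXM)
  have hent := hF C X S hCX hC hX h
  rcases mem_markovBlanket.1 hXM with h1 | h1 | ⟨-, Y, h1, h2⟩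
  · exact (not_entails_of_adj hG h1 hX hC).2 hent
  · exact (not_entails_of_adj hG h1 hC hX).1 hent
  · exact not_entails_of_collider hG h1 h2 hCX hC hX (hch Y h1 (hG.ne_of_adj h2).symm) hent

/-- The children of `C` have to be found before its spouses: only when they are conditioned on do
the spouses become dependent on `C`. -/
lemma Faithful.markovBlanket_subset_of_condIndep (hF : Faithful G P) (hG : IsDAG G) {C : V}
    {S : Finset V} (hS : S ⊆ features C)
    (h : ∀ X ∈ features C \ S, CondIndep P {C} {X} S) : markovBlanket G C ⊆ S := by
  have hC : C ∉ S := fun e => mem_features.1 (hS e) rfl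
  have hch : ∀ Y, G.Adj C Y → Y ∈ S := by
    intro Y hY
    by_contra hYS
    have hCY := hG.ne_of_adj hY
    exact (not_entails_of_adj hG hY hC hYS).1 (hF C Y S hCY hC hYS
      (h Y (Finset.mem_sdiff.2 ⟨mem_features.2 hCY.symm, hYS⟩)))
  intro X hX
  by_contra hXS
  refine hF.not_condIndep hG hC hXS hX (fun Y hY _ => hch Y hY)
    (h X (Finset.mem_sdiff.2 ⟨mem_features.2 ?_, hXS⟩))
  rintro rfl
  exact hG.notMem_markovBlanket _ hX

lemma condMutualInfo_eq_zero_of_markovBlanket_subset (h : IsBayesianNetwork G P) {C Y : V}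
    {S : Finset V} (hS : markovBlanket G C ⊆ S) (hSF : S ⊆ features C) (hY : Y ∈ features C) :
    condMutualInfo P {C} {Y} S = 0 := by
  have hi : {Y} ∪ S ⊆ features C := Finset.union_subset (by simpa using hY) hSF
  have := mutualInfo_union P {C} {Y} S
  rw [mutualInfo_eq_of_markovBlanket_subset h hS hSF,
    mutualInfo_eq_of_markovBlanket_subset h (hS.trans Finset.subset_union_right) hi] at this
  linarith

lemma subset_features_of_forward {C : V} {S : Finset V}
    (h : Relation.ReflTransGen (ForwardStep P C) ∅ S) : S ⊆ features C := by
  induction h with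
  | refl => exact Finset.empty_subset _
  | tail _ hstep ih =>
    obtain ⟨X, hX, -, -, rfl⟩ := hstep
    exact Finset.insert_subset (Finset.mem_sdiff.1 hX).1 ih

lemma markovBlanket_subset_of_forwardResult (hBN : IsBayesianNetwork G P) (hF : Faithful G P)
    {C : V} {S : Finset V} (h : IsForwardResult P C S) : markovBlanket G C ⊆ S :=
  hF.markovBlanket_subset_of_condIndep hBN.1 (subset_features_of_forward h.1) fun X hX =>
    (condMutualInfo_eq_zero_iff P _ _ _).1 (h.2 X hX)

lemma markovBlanket_subset_of_backward (hBN : IsBayesianNetwork G P) (hF : Faithful G P)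
    {C : V} {S T : Finset V} (hSF : S ⊆ features C) (hS : markovBlanket G C ⊆ S)
    (h : Relation.ReflTransGen (BackwardStep P C) S T) :
    markovBlanket G C ⊆ T ∧ T ⊆ features C := by
  induction h with
  | refl => exact ⟨hS, hSF⟩
  | @tail T T' _ hstep ih =>
    obtain ⟨Y, hY, h0, rfl⟩ := hstep
    refine ⟨?_, (Finset.erase_subset _ _).trans ih.2⟩
    have hYM : Y ∉ markovBlanket G C := fun hYM =>
      hF.not_condIndep hBN.1 (fun e => mem_features.1 (ih.2 (Finset.mem_of_mem_erase e)) rfl)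
        (Finset.notMem_erase Y T) hYM
        (fun Z hZ hne => Finset.mem_erase.2 ⟨hne, ih.1 (mem_markovBlanket.2 (.inr (.inl hZ)))⟩)
        ((condMutualInfo_eq_zero_iff P _ _ _).1 h0)
    exact fun X hX => Finset.mem_erase.2 ⟨fun e => hYM (e ▸ hX), ih.1 hX⟩

lemma eq_markovBlanket_of_backwardResult (hBN : IsBayesianNetwork G P) (hF : Faithful G P)
    {C : V} {S T : Finset V} (hSF : S ⊆ features C) (hS : markovBlanket G C ⊆ S)
    (h : IsBackwardResult P C S T) : T = markovBlanket G C := by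
  obtain ⟨hMT, hTF⟩ := markovBlanket_subset_of_backward hBN hF hSF hS h.1
  refine Finset.Subset.antisymm (fun Y hY => ?_) hMT
  by_contra hYM
  have hM : markovBlanket G C ⊆ T.erase Y := fun X hX =>
    Finset.mem_erase.2 ⟨fun e => hYM (e ▸ hX), hMT hX⟩
  exact (h.2 Y hY).ne' (condMutualInfo_eq_zero_of_markovBlanket_subset hBN hM
    ((Finset.erase_subset _ _).trans hTF) (hTF hY))

/-- A loop whose body decreases a natural number and can be entered whenever the exit condition
fails terminates. -/
lemma loopTerminates_of_measure {σ : Type*} {step : σ → σ → Prop} {halt : σ → Prop} (μ : σ → ℕ)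
    (hμ : ∀ s t, step s t → μ t < μ s) (hstep : ∀ s, halt s ∨ ∃ t, step s t) (s : σ) :
    LoopTerminates step halt s := by
  refine ⟨?_, fun t _ => hstep t⟩
  rintro ⟨r, -, hr⟩
  have : ∀ n, μ (r n) + n ≤ μ (r 0) := by
    intro n
    induction n with
    | zero => simp
    | succ n ih => have := hμ _ _ (hr n); omega
  have := this (μ (r 0) + 1)
  omega

lemma LoopTerminates.exists_result {σ : Type*} {step : σ → σ → Prop} {halt : σ → Prop} {s : σ}
    (h : LoopTerminates step halt s) : ∃ t, LoopResult step halt s t := by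
  by_contra hno
  have hnext : ∀ t : {t // Relation.ReflTransGen step s t},
      ∃ t' : {t // Relation.ReflTransGen step s t}, step t.1 t'.1 := by
    rintro ⟨t, ht⟩
    rcases h.2 t ht with hh | ⟨t', ht'⟩
    · exact absurd ⟨t, ht, hh⟩ hno
    · exact ⟨⟨t', ht.tail ht'⟩, ht'⟩
  choose next hn using hnext
  refine h.1 ⟨fun n => (next^[n] ⟨s, .refl⟩).1, rfl, fun n => ?_⟩
  simp only [Function.iterate_succ_apply']
  exact hn _

lemma forward_loopTerminates (P : PMF (∀ v, Ω v)) (C : V) (S : Finset V) :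
    LoopTerminates (ForwardStep P C) (ForwardStop P C) S := by
  refine loopTerminates_of_measure (fun S => (features C \ S).card) ?_ ?_ S
  · rintro S _ ⟨X, hX, -, -, rfl⟩
    refine Finset.card_lt_card ((Finset.ssubset_iff_of_subset ?_).2 ⟨X, hX, by simp⟩)
    exact Finset.sdiff_subset_sdiff le_rfl (Finset.subset_insert X S)
  · intro S
    by_cases hend : ForwardStop P C S
    · exact .inl hend
    · simp only [ForwardStop, not_forall] at hend
      obtain ⟨Z, hZ, hZ0⟩ := hend
      obtain ⟨X, hX, hmax⟩ := Finset.exists_max_image (features C \ S)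
        (fun X => condMutualInfo P {C} {X} S) ⟨Z, hZ⟩
      have hpos := lt_of_le_of_ne (condMutualInfo_nonneg P {C} {Z} S) (Ne.symm hZ0)
      exact .inr ⟨_, X, hX, hmax, hpos.trans_le (hmax Z hZ), rfl⟩

lemma backward_loopTerminates (P : PMF (∀ v, Ω v)) (C : V) (S : Finset V) :
    LoopTerminates (BackwardStep P C) (BackwardStop P C) S := by
  refine loopTerminates_of_measure Finset.card ?_ ?_ S
  · rintro S _ ⟨Y, hY, -, rfl⟩
    exact Finset.card_erase_lt_of_mem hY
  · intro S
    by_cases hend : BackwardStop P C S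
    · exact .inl hend
    · simp only [BackwardStop, not_forall, not_lt] at hend
      obtain ⟨Y, hY, h0⟩ := hend
      exact .inr ⟨_, Y, hY, le_antisymm h0 (condMutualInfo_nonneg P _ _ _), rfl⟩

lemma isLeast_markovBlanket (hBN : IsBayesianNetwork G P) (hF : Faithful G P) (C : V) :
    IsLeast {S | IsOptimal P C S} (markovBlanket G C) := by
  have hMF : markovBlanket G C ⊆ features C := fun v hv =>
    mem_features.2 fun e => hBN.1.notMem_markovBlanket C (e ▸ hv)
  refine ⟨⟨hMF, fun T hT => ?_⟩, fun S ⟨hSF, hS⟩ => ?_⟩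
  · rw [mutualInfo_eq_of_markovBlanket_subset hBN le_rfl hMF]
    exact mutualInfo_mono P {C} hT
  · refine hF.markovBlanket_subset_of_condIndep hBN.1 hSF fun X hX => ?_
    -- adding `X` to a maximizer cannot increase the mutual information
    have hle := hS ({X} ∪ S)
      (Finset.union_subset (by simpa using (Finset.mem_sdiff.1 hX).1) hSF)
    rw [mutualInfo_union] at hle
    rw [← condMutualInfo_eq_zero_iff]
    exact le_antisymm (by linarith) (condMutualInfo_nonneg P _ _ _)

end Correctness

end

theorem theorem3 {V : Type*} [Fintype V] [DecidableEq V]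
    {Ω : V → Type*} [∀ v, Fintype (Ω v)]
    (G : Digraph V) (P : PMF (∀ v, Ω v))
    (hBN : IsBayesianNetwork G P) (hF : Faithful G P) (C : V) :
    -- the forward phase terminates, and its result contains the Markov blanket
    LoopTerminates (ForwardStep P C) (ForwardStop P C) ∅ ∧
    (∀ S, IsForwardResult P C S → markovBlanket G C ⊆ S) ∧
    -- the backward phase terminates and removes exactly the false positives
    (∀ S, IsForwardResult P C S →
      LoopTerminates (BackwardStep P C) (BackwardStop P C) S ∧
      ∀ T, IsBackwardResult P C S T → T = markovBlanket G C) ∧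
    -- the output of IAMB is the Markov blanket
    (∀ T, IsIAMBOutput P C T ↔ T = markovBlanket G C) ∧
    -- it maximizes the mutual information with the class, and is the least set that does
    (∀ T, IsIAMBOutput P C T → IsLeast {S | IsOptimal P C S} T) := by
  have hfwd : ∀ S, IsForwardResult P C S → markovBlanket G C ⊆ S := fun S hS =>
    markovBlanket_subset_of_forwardResult hBN hF hS
  have hbwd : ∀ S, IsForwardResult P C S → ∀ T, IsBackwardResult P C S T →
      T = markovBlanket G C := fun S hS T hT =>
    eq_markovBlanket_of_backwardResult hBN hF (subset_features_of_forward hS.1) (hfwd S hS) hT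
  have hout : ∀ T, IsIAMBOutput P C T ↔ T = markovBlanket G C := by
    refine fun T => ⟨fun ⟨S, hS, hT⟩ => hbwd S hS T hT, ?_⟩
    rintro rfl
    -- some run exists because both phases terminate, and every run returns the blanket
    obtain ⟨S, hS⟩ := (forward_loopTerminates P C ∅).exists_result
    obtain ⟨T, hT⟩ := (backward_loopTerminates P C S).exists_result
    exact ⟨S, hS, hbwd S hS T hT ▸ hT⟩
  refine ⟨forward_loopTerminates P C ∅, hfwd,
    fun S hS => ⟨backward_loopTerminates P C S, hbwd S hS⟩, hout, fun T hT => ?_⟩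
  rw [(hout T).1 hT]
  exact isLeast_markovBlanket hBN hF C
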